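/- All rings are commutative and unital. A derivation $D : R \to R$ of a ring $R$ is an additive map satisfying the Leibniz rule; it is \emph{locally nilpotent} if for each $r \in R$ there exists $m > 0$ with $D^m(r) = 0$. The ring $R$ is \emph{rigid} if its only locally nilpotent derivation is $0$, and \emph{non-rigid} otherwise. If $B = \bigoplus_{i \in \mathbb{Z}} B_i$ is a $\mathbb{Z}$-graded ring and $d \ge 1$ is an integer, let $B^{(d)} = \bigoplus_{i \in d\mathbb{Z}} B_i$, a subring of $B$. Let $\mathbf{k}$ be a field of characteristic zero and let $B = \bigoplus_{i \in \mathbb{Z}} B_i$ be a $\mathbb{Z}$-graded integral domain that is integrally closed in its field of fractions and is a finitely generated $\mathbf{k}$-algebra. Suppose that $B = B_0[x_1, \dots, x_n]$ where $n \ge 2$ and, for each $i \in \{1, \dots, n\}$, $x_i$ is a prime element of $B$ that is homogeneous of degree $d_i \in \mathbb{Z} \setminus \{0\}$. Assume that (i) for every $i \in \{1, \dots, n\}$, the greatest common divisor of the $n-1$ integers $d_j$ with $j \neq i$ is $1$; (ii) for every choice of distinct $i, j \in \{1, \dots, n\}$, $x_i$ and $x_j$ are not associates in $B$. Then the following are equivalent: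 (a) $B$ is non-rigid; (b) $B^{(d)}$ is non-rigid for all $d \ge 1$; (c) $B^{(d)}$ is non-rigid for some $d \ge 1$. -/

import Mathlib

/-- A derivation `D : R → R` is locally nilpotent if every element of `R` is killed by some
iterate of `D`. -/
def IsLocallyNilpotentDerivation {R : Type*} [CommRing R] (D : Derivation ℤ R R) : Prop :=
  ∀ r : R, ∃ m : ℕ, D^[m] r = 0

/-- A ring is rigid if its only locally nilpotent derivation is zero. Derivations of a ring are
additive maps satisfying the Leibniz rule, that is, `ℤ`-linear derivations. -/
def IsRigidRing (R : Type*) [CommRing R] : Prop :=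
  ∀ D : Derivation ℤ R R, IsLocallyNilpotentDerivation D → D = 0

/-- The subring `B^(d) = ⨁_{i ∈ dℤ} B_i` of a `ℤ`-graded ring `B`: the elements all of whose
nonzero homogeneous components have degree divisible by `d`. -/
def veroneseSubring {B : Type*} [CommRing B] (𝒜 : ℤ → AddSubgroup B) [GradedRing 𝒜] (d : ℕ) :
    Subring B where
  carrier := {b | ∀ i : ℤ, ¬ (d : ℤ) ∣ i → GradedRing.proj 𝒜 i b = 0}
  zero_mem' := fun i _ => map_zero _
  one_mem' := fun i hi => by
    have h : i ≠ 0 := fun h => hi (h ▸ dvd_zero _)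
    rw [GradedRing.proj_apply,
      DirectSum.decompose_of_mem_ne 𝒜 SetLike.GradedOne.one_mem (Ne.symm h)]
  add_mem' := fun {a b} ha hb i hi => by rw [map_add, ha i hi, hb i hi, add_zero]
  neg_mem' := fun {a} ha i hi => by rw [map_neg, ha i hi, neg_zero]
  mul_mem' := fun {a b} ha hb i hi => by
    classical
    rw [← DirectSum.sum_support_decompose 𝒜 a, ← DirectSum.sum_support_decompose 𝒜 b,
      Finset.sum_mul_sum, map_sum]
    refine Finset.sum_eq_zero fun j _ => ?_
    rw [map_sum]
    refine Finset.sum_eq_zero fun l _ => ?_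
    by_cases hj : (d : ℤ) ∣ j
    · by_cases hl : (d : ℤ) ∣ l
      · have hne : j + l ≠ i := fun h => hi (h ▸ dvd_add hj hl)
        rw [GradedRing.proj_apply, DirectSum.decompose_of_mem_ne 𝒜
          (SetLike.GradedMul.mul_mem (SetLike.coe_mem _) (SetLike.coe_mem _)) hne]
      · have h0 := hb l hl
        rw [GradedRing.proj_apply] at h0
        rw [h0, mul_zero, map_zero]
    · have h0 := ha j hj
      rw [GradedRing.proj_apply] at h0
      rw [h0, zero_mul, map_zero]

/-!
Let `D` be a nonzero locally nilpotent derivation of `B`. As `B` is finitely generated, `D` has a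
top homogeneous component, which is again locally nilpotent; so let `D` be homogeneous, of degree
`e`. If the degree of a homogeneous prime `z` is not in the group generated by the degrees of the
kernel elements, then `z` divides a homogeneous `s` with `D s ≠ 0` and `D² s = 0`. An `s` of this
kind is not divisible by two non-associate primes outside the kernel, so all but at most one of the
`δ j` lie in that group, which is `ℤ` by the gcd condition. Hence `D` can be multiplied by a kernel
element of degree congruent to `-e` modulo `d`, and the product restricts to `B^(d)`.

Conversely, let `D` be a locally nilpotent derivation of `B^(d)`. Since `B` is integral over
`B^(d)`, `D` extends to a derivation `E` of the fraction field of `B`. For each `i` and each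
homogeneous `b`, the gcd condition supplies a monomial `u` in the `x j`, `j ≠ i`, with `u * b` in
`B^(d)`, and then a power of `u` is a denominator of `d E b`. Such denominators for varying `i`
have no common prime factor, so `d E` maps `B` into itself. It is locally nilpotent because
`b ^ d ∈ B^(d)` for `b` homogeneous, and the degree of `(d E b) ^ d` with respect to `d E` is
smaller than that of `b ^ d`.
-/

section NilDegree

theorem derivation_iterate_mul {S R : Type*} [CommRing S] [CommRing R] [Algebra S R]
    (D : Derivation S R R) (n : ℕ) (a b : R) :
    D^[n] (a * b) =
      ∑ ij ∈ Finset.HasAntidiagonal.antidiagonal n, n.choose ij.1 • (D^[ij.1] a * D^[ij.2] b) := by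
  induction n with
  | zero => simp
  | succ n ih =>
    rw [Finset.sum_antidiagonal_choose_succ_nsmul (fun i j => D^[i] a * D^[j] b),
      Function.iterate_succ_apply', ih, map_sum, ← Finset.sum_add_distrib]
    refine Finset.sum_congr rfl fun ⟨i, j⟩ hij => ?_
    rw [n.choose_symm_of_eq_add (Finset.HasAntidiagonal.mem_antidiagonal.1 hij).symm]
    simp only [map_nsmul, Derivation.leibniz, Function.iterate_succ_apply', smul_eq_mul,
      nsmul_add, mul_comm (D^[j] b)]

variable {R : Type*} [CommRing R] {D : Derivation ℤ R R} {a b : R} {m n : ℕ}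

theorem iterate_mul_of_apply_eq_zero (ha : D a = 0) (n : ℕ) (b : R) :
    D^[n] (a * b) = a * D^[n] b := by
  have hcomm : Function.Commute D (a * ·) := fun c => by simp [ha]
  exact hcomm.iterate_left n b

theorem iterate_eq_zero_of_le (h : D^[m] b = 0) (hmn : m ≤ n) : D^[n] b = 0 := by
  obtain ⟨l, rfl⟩ := Nat.exists_eq_add_of_le' hmn
  rw [Function.iterate_add_apply, h, iterate_map_zero]

/-- `b` has degree `m` with respect to `D`: the number `m` is the last one for which `D^m b` does
not vanish. On a domain of characteristic zero this degree turns products into sums. The element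
`0` has no degree. -/
def HasNilDegree (D : Derivation ℤ R R) (b : R) (m : ℕ) : Prop :=
  D^[m] b ≠ 0 ∧ D^[m + 1] b = 0

theorem hasNilDegree_zero_iff : HasNilDegree D b 0 ↔ b ≠ 0 ∧ D b = 0 := Iff.rfl

theorem hasNilDegree_succ_iff : HasNilDegree D b (m + 1) ↔ HasNilDegree D (D b) m := Iff.rfl

theorem exists_hasNilDegree (hD : ∃ m : ℕ, D^[m] b = 0) (hb : b ≠ 0) :
    ∃ m, HasNilDegree D b m := by
  classical
  obtain ⟨m, hm⟩ := Nat.exists_eq_succ_of_ne_zero fun h : Nat.find hD = 0 =>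
    hb (by simpa [h] using Nat.find_spec hD)
  exact ⟨m, Nat.find_min hD (hm ▸ m.lt_succ_self), by simpa only [hm] using Nat.find_spec hD⟩

namespace HasNilDegree

theorem unique (hm : HasNilDegree D b m) (hn : HasNilDegree D b n) : m = n :=
  le_antisymm (not_lt.1 fun h => hm.1 (iterate_eq_zero_of_le hn.2 h))
    (not_lt.1 fun h => hn.1 (iterate_eq_zero_of_le hm.2 h))

theorem ne_zero (hm : HasNilDegree D b m) : b ≠ 0 := by
  rintro rfl
  exact hm.1 (iterate_map_zero D m)

variable [IsDomain R] [CharZero R]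

theorem mul (ha : HasNilDegree D a m) (hb : HasNilDegree D b n) :
    HasNilDegree D (a * b) (m + n) := by
  have hvanish {i j : ℕ} (hij : m < i ∨ n < j) : D^[i] a * D^[j] b = 0 := by
    rcases hij with hi | hj
    · rw [iterate_eq_zero_of_le ha.2 hi, zero_mul]
    · rw [iterate_eq_zero_of_le hb.2 hj, mul_zero]
  constructor
  · rw [derivation_iterate_mul, Finset.sum_eq_single (m, n)]
    · exact smul_ne_zero (Nat.choose_pos (Nat.le_add_right m n)).ne' (mul_ne_zero ha.1 hb.1)
    · rintro ⟨i, j⟩ hij hne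
      have hsum : i + j = m + n := Finset.HasAntidiagonal.mem_antidiagonal.1 hij
      rw [hvanish (by by_contra!; exact hne (Prod.ext (by lia) (by lia))), smul_zero]
    · exact fun h => (h (Finset.HasAntidiagonal.mem_antidiagonal.2 rfl)).elim
  · rw [derivation_iterate_mul]
    refine Finset.sum_eq_zero fun ⟨i, j⟩ hij => ?_
    have hsum : i + j = m + n + 1 := Finset.HasAntidiagonal.mem_antidiagonal.1 hij
    rw [hvanish (by lia), smul_zero]

theorem pow (ha : HasNilDegree D a m) (n : ℕ) : HasNilDegree D (a ^ n) (n * m) := by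
  induction n with
  | zero =>
    rw [pow_zero, zero_mul]
    exact hasNilDegree_zero_iff.2 ⟨one_ne_zero, D.map_one_eq_zero⟩
  | succ n ih =>
    rw [pow_succ, Nat.succ_mul]
    exact ih.mul ha

end HasNilDegree

namespace IsLocallyNilpotentDerivation

theorem smul (hD : IsLocallyNilpotentDerivation D) (ha : D a = 0) :
    IsLocallyNilpotentDerivation (a • D) := by
  intro b
  obtain ⟨m, hm⟩ := hD b
  have hcomm : Function.Commute (a * ·) D := fun c => by simp [ha]
  refine ⟨m, ?_⟩
  calc (a • D)^[m] b = ((a * ·)^[m] ∘ D^[m]) b := congr_fun (hcomm.comp_iterate m) b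
    _ = 0 := by simp only [Function.comp_apply, hm, mul_left_iterate, mul_zero]

variable [IsDomain R] [CharZero R]

theorem apply_eq_zero_of_dvd (hD : IsLocallyNilpotentDerivation D) (hab : a ∣ b) (hb : b ≠ 0)
    (hDb : D b = 0) : D a = 0 := by
  obtain ⟨c, rfl⟩ := hab
  obtain ⟨m, hm⟩ := exists_hasNilDegree (hD a) (left_ne_zero_of_mul hb)
  obtain ⟨n, hn⟩ := exists_hasNilDegree (hD c) (right_ne_zero_of_mul hb)
  have hdeg := (hm.mul hn).unique (hasNilDegree_zero_iff.2 ⟨hb, hDb⟩)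
  obtain rfl : m = 0 := by lia
  exact hm.2

theorem apply_eq_zero_of_isUnit (hD : IsLocallyNilpotentDerivation D) (ha : IsUnit a) :
    D a = 0 :=
  hD.apply_eq_zero_of_dvd ha.dvd one_ne_zero D.map_one_eq_zero

theorem apply_eq_zero_of_mul_dvd (hD : IsLocallyNilpotentDerivation D) {s : R}
    (hs : HasNilDegree D s 1) (hab : a * b ∣ s) : D a = 0 ∨ D b = 0 := by
  obtain ⟨c, rfl⟩ := hab
  obtain ⟨hab0, hc0⟩ := mul_ne_zero_iff.1 hs.ne_zero
  obtain ⟨l, hl⟩ := exists_hasNilDegree (hD a) (left_ne_zero_of_mul hab0)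
  obtain ⟨m, hm⟩ := exists_hasNilDegree (hD b) (right_ne_zero_of_mul hab0)
  obtain ⟨n, hn⟩ := exists_hasNilDegree (hD c) hc0
  have hdeg := ((hl.mul hm).mul hn).unique hs
  obtain rfl | rfl : l = 0 ∨ m = 0 := by lia
  exacts [Or.inl hl.2, Or.inr hm.2]

end IsLocallyNilpotentDerivation

theorem smul_derivation_ne_zero [IsDomain R] (ha : a ≠ 0) (hD : D ≠ 0) : a • D ≠ 0 := fun h =>
  hD <| Derivation.ext fun b => (mul_eq_zero_iff_left ha).1 (DFunLike.congr_fun h b)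

theorem mul_derivation_pow (D : Derivation ℤ R R) (b : R) (d : ℕ) :
    b * D (b ^ d) = d • (b ^ d * D b) := by
  rcases d with - | d
  · simp
  · rw [Derivation.leibniz_pow, Nat.add_sub_cancel, smul_eq_mul, mul_smul_comm, pow_succ',
      mul_assoc]

section PowNilpotent

variable [IsDomain R] [CharZero R] {d : ℕ} [NeZero d]

-- Comparing the degrees of the two sides of `b ^ d * D (b ^ d) ^ d = d ^ d (b ^ d) ^ d (D b) ^ d`.
theorem HasNilDegree.derivation_pow_add {q : ℕ} (hm : HasNilDegree D (b ^ d) m)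
    (hq : HasNilDegree D (D b ^ d) q) : q + d = m := by
  have hd : (d : R) ≠ 0 := NeZero.ne _
  have hb : b ≠ 0 := fun h => hm.ne_zero (by rw [h, zero_pow (NeZero.ne d)])
  have hDb : D b ≠ 0 := fun h => hq.ne_zero (by rw [h, zero_pow (NeZero.ne d)])
  obtain ⟨l, rfl⟩ : ∃ l, m = l + 1 := by
    refine Nat.exists_eq_succ_of_ne_zero ?_
    rintro rfl
    have h := mul_derivation_pow D b d
    rw [(hasNilDegree_zero_iff.1 hm).2, mul_zero, eq_comm, nsmul_eq_mul] at h
    exact mul_ne_zero hd (mul_ne_zero (pow_ne_zero d hb) hDb) h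
  have hconst : HasNilDegree D ((d : R) ^ d) 0 :=
    hasNilDegree_zero_iff.2 ⟨pow_ne_zero d hd, by rw [← Nat.cast_pow, D.map_natCast]⟩
  have hpow : b ^ d * D (b ^ d) ^ d = (d : R) ^ d * ((b ^ d) ^ d * D b ^ d) := by
    rw [← mul_pow, mul_derivation_pow, nsmul_eq_mul, mul_pow, mul_pow]
  have hleft := hm.mul ((hasNilDegree_succ_iff.1 hm).pow d)
  have hright := hconst.mul ((hm.pow d).mul hq)
  have hdeg := (hpow ▸ hleft).unique hright
  rw [Nat.mul_succ] at hdeg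
  lia

theorem exists_iterate_eq_zero_of_pow {S : Set R} (hS : Set.MapsTo D S S)
    (hpow : ∀ b ∈ S, ∃ m : ℕ, D^[m] (b ^ d) = 0) (hb : b ∈ S) : ∃ n : ℕ, D^[n] b = 0 := by
  rcases eq_or_ne b 0 with rfl | hb0
  · exact ⟨0, rfl⟩
  obtain ⟨m, hm⟩ := exists_hasNilDegree (hpow b hb) (pow_ne_zero d hb0)
  induction m using Nat.strong_induction_on generalizing b with
  | _ m ih =>
    rcases eq_or_ne (D b) 0 with hDb | hDb
    · exact ⟨1, hDb⟩
    obtain ⟨q, hq⟩ := exists_hasNilDegree (hpow _ (hS hb)) (pow_ne_zero d hDb)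
    have hlt : q < m := by
      have := hm.derivation_pow_add hq
      have := Nat.pos_of_neZero d
      lia
    obtain ⟨n, hn⟩ := ih q hlt (hS hb) hDb hq
    exact ⟨n + 1, hn⟩

end PowNilpotent

end NilDegree

section Semiconj

open Function (Semiconj)

theorem exists_derivation_semiconj {A B : Type*} [CommRing A] [CommRing B] [Algebra A B]
    [FaithfulSMul A B] (E : Derivation ℤ B B)
    (hE : ∀ a, E (algebraMap A B a) ∈ (algebraMap A B).range) :
    ∃ D : Derivation ℤ A A, Semiconj (algebraMap A B) D E := by
  have hinj : Function.Injective (algebraMap A B) := FaithfulSMul.algebraMap_injective A B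
  choose f hf using hE
  refine ⟨Derivation.mk' (AddMonoidHom.mk' f fun a b => hinj ?_).toIntLinearMap
    fun a b => hinj ?_, hf⟩
  · simp only [map_add, hf]
  · simp [hf]

theorem exists_derivation_extend_of_isAlgebraic {S R L : Type*} [CommRing S] [CommRing R]
    [IsDomain R] [CharZero R] [Field L] [Algebra S R] [Algebra S L] [Algebra R L]
    [IsScalarTower S R L] [FaithfulSMul R L] [Algebra.IsAlgebraic R L] (D : Derivation S R R) :
    ∃ E : Derivation S L L, Semiconj (algebraMap R L) D E := by
  let : Algebra (FractionRing R) L := FractionRing.liftAlgebra R L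
  have : Algebra.IsAlgebraic (FractionRing R) L :=
    (IsFractionRing.comap_isAlgebraic_iff (A := R) (K := FractionRing R)).1 inferInstance
  have : Algebra.FormallyEtale R (FractionRing R) :=
    Algebra.FormallyEtale.of_isLocalization (nonZeroDivisors R)
  have : CharZero (FractionRing R) :=
    charZero_of_injective_algebraMap (IsFractionRing.injective R (FractionRing R))
  have : Algebra.FormallyEtale (FractionRing R) L := Algebra.FormallyEtale.of_isSeparable _ _
  have : Algebra.FormallyEtale R L := Algebra.FormallyEtale.comp R (FractionRing R) L
  -- As `L` is formally étale over `R`, its differentials are `L ⊗[R] Ω[R⁄S]`, so `D` lifts.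
  let ψ : Ω[L⁄S] →ₗ[L] L :=
    ((Algebra.linearMap R L ∘ₗ D.liftKaehlerDifferential).liftBaseChange L) ∘ₗ
      (KaehlerDifferential.tensorKaehlerEquivOfFormallyEtale S R L).symm.toLinearMap
  refine ⟨ψ.compDer (KaehlerDifferential.D S L), fun r => ?_⟩
  simp [ψ, KaehlerDifferential.tensorKaehlerEquivOfFormallyEtale_symm_D_algebraMap S R L r]

variable {A B : Type*} [CommRing A] [CommRing B] [Algebra A B] [FaithfulSMul A B]
  {D : Derivation ℤ A A} {E : Derivation ℤ B B}

theorem iterate_algebraMap_eq_zero_iff (h : Semiconj (algebraMap A B) D E) {n : ℕ} {a : A} :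
    E^[n] (algebraMap A B a) = 0 ↔ D^[n] a = 0 := by
  rw [← (h.iterate_right n).eq, map_eq_zero_iff _ (FaithfulSMul.algebraMap_injective A B)]

theorem IsLocallyNilpotentDerivation.of_semiconj (hE : IsLocallyNilpotentDerivation E)
    (h : Semiconj (algebraMap A B) D E) : IsLocallyNilpotentDerivation D := fun a =>
  (hE (algebraMap A B a)).imp fun _ => (iterate_algebraMap_eq_zero_iff h).1

end Semiconj

section DegreeSubgroup

variable {Γ B : Type*} [CommRing B] (𝒜 : Γ → AddSubgroup B)

/-- The subgroup of `Γ` generated by the degrees of the homogeneous elements of a submonoid of a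
`Γ`-graded ring. It measures which degrees can be corrected by multiplying with elements of the
submonoid. The element `0`, if it lies in the submonoid, contributes every degree. -/
def degreeSubgroup [AddGroup Γ] (M : Submonoid B) : AddSubgroup Γ :=
  AddSubgroup.closure {i | ∃ u ∈ M, u ∈ 𝒜 i}

theorem mem_degreeSubgroup [AddGroup Γ] {M : Submonoid B} {u : B} (hu : u ∈ M) {i : Γ}
    (hi : u ∈ 𝒜 i) : i ∈ degreeSubgroup 𝒜 M :=
  AddSubgroup.subset_closure ⟨u, hu, hi⟩

/-- The submonoid of nonzero elements of the kernel of a derivation of a domain: the elements by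
which a nonzero locally nilpotent derivation can be multiplied to give another one. -/
def kernelSubmonoid [IsDomain B] (D : Derivation ℤ B B) : Submonoid B where
  carrier := {f | f ≠ 0 ∧ D f = 0}
  one_mem' := ⟨one_ne_zero, D.map_one_eq_zero⟩
  mul_mem' := fun ha hb => ⟨mul_ne_zero ha.1 hb.1, by simp [ha.2, hb.2]⟩

end DegreeSubgroup

section Graded

open DirectSum

variable {Γ B : Type*} [DecidableEq Γ] [CommRing B] (𝒜 : Γ → AddSubgroup B)

section Support

variable [AddMonoid Γ] [GradedRing 𝒜]

theorem proj_of_mem {i : Γ} {b : B} (hb : b ∈ 𝒜 i) : GradedRing.proj 𝒜 i b = b :=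
  decompose_of_mem_same 𝒜 hb

theorem proj_of_mem_ne {i j : Γ} {b : B} (hb : b ∈ 𝒜 i) (hij : i ≠ j) :
    GradedRing.proj 𝒜 j b = 0 :=
  decompose_of_mem_ne 𝒜 hb hij

theorem proj_mem (i : Γ) (b : B) : GradedRing.proj 𝒜 i b ∈ 𝒜 i :=
  SetLike.coe_mem _

/-- The additive subgroup `⨁_{i ∈ S} B_i` of a graded ring `B = ⨁ B_i`: the elements whose nonzero
homogeneous components all have degree in `S`. Half-lines `S` filter `B` by degree, and the residue
classes modulo `d` group `B` into modules over `B^(d)`. -/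
def supportedIn (S : Set Γ) : AddSubgroup B where
  carrier := {b | ∀ i ∉ S, GradedRing.proj 𝒜 i b = 0}
  zero_mem' := fun _ _ => map_zero _
  add_mem' := fun ha hb i hi => by rw [map_add, ha i hi, hb i hi, add_zero]
  neg_mem' := fun ha i hi => by rw [map_neg, ha i hi, neg_zero]

theorem le_supportedIn {S : Set Γ} {i : Γ} (hi : i ∈ S) : 𝒜 i ≤ supportedIn 𝒜 S :=
  fun _ hb _ hj => proj_of_mem_ne 𝒜 hb fun hij => hj (hij ▸ hi)

theorem supportedIn_le {S : Set Γ} {T : AddSubgroup B} (h : ∀ i ∈ S, 𝒜 i ≤ T) :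
    supportedIn 𝒜 S ≤ T := by
  classical
  intro b hb
  rw [← sum_support_decompose 𝒜 b]
  refine sum_mem fun i hi => h i ?_ (SetLike.coe_mem _)
  by_contra hiS
  exact (GradedRing.mem_support_iff 𝒜 b i).1 hi (hb i hiS)

theorem supportedIn_singleton (i : Γ) : supportedIn 𝒜 {i} = 𝒜 i :=
  le_antisymm (supportedIn_le 𝒜 fun _ hj => hj ▸ le_rfl) (le_supportedIn 𝒜 rfl)

theorem eq_zero_of_forall_proj_eq_zero {b : B} (h : ∀ i, GradedRing.proj 𝒜 i b = 0) : b = 0 :=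
  AddSubgroup.mem_bot.1 (supportedIn_le 𝒜 (S := ∅) (by simp) fun i _ => h i)

theorem exists_finset_mem_supportedIn (b : B) :
    ∃ S : Finset Γ, b ∈ supportedIn 𝒜 (S : Set Γ) ∧ ∀ i ∈ S, GradedRing.proj 𝒜 i b ≠ 0 := by
  classical
  refine ⟨(decompose 𝒜 b).support, fun i hi => ?_, fun i => (GradedRing.mem_support_iff 𝒜 b i).1⟩
  by_contra hne
  exact hi ((GradedRing.mem_support_iff 𝒜 b i).2 hne)

theorem mul_mem_supportedIn {S T U : Set Γ} (hU : ∀ i ∈ S, ∀ j ∈ T, i + j ∈ U) {a b : B}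
    (ha : a ∈ supportedIn 𝒜 S) (hb : b ∈ supportedIn 𝒜 T) : a * b ∈ supportedIn 𝒜 U := by
  have hleft : supportedIn 𝒜 S ≤ (supportedIn 𝒜 U).comap (AddMonoidHom.mulRight b) :=
    supportedIn_le 𝒜 fun i hi a ha =>
      have hright : supportedIn 𝒜 T ≤ (supportedIn 𝒜 U).comap (AddMonoidHom.mulLeft a) :=
        supportedIn_le 𝒜 fun j hj b hb =>
          le_supportedIn 𝒜 (hU i hi j hj) (SetLike.mul_mem_graded ha hb)
      hright hb
  exact hleft ha

theorem proj_mul_of_uniqueAdd {S T : Finset Γ} {a b : B} (ha : a ∈ supportedIn 𝒜 (S : Set Γ))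
    (hb : b ∈ supportedIn 𝒜 (T : Set Γ)) {p q : Γ} (h : UniqueAdd S T p q) :
    GradedRing.proj 𝒜 (p + q) (a * b) = GradedRing.proj 𝒜 p a * GradedRing.proj 𝒜 q b := by
  classical
  rw [GradedRing.proj_apply, decompose_mul, coe_mul_apply]
  refine Finset.sum_eq_single (p, q) ?_ fun hpq => ?_
  · rintro ⟨i, j⟩ hij hne
    simp only [Finset.mem_filter, Finset.mem_product, GradedRing.mem_support_iff] at hij
    have hi : i ∈ S := by_contra fun hi => hij.1.1 (ha i hi)
    have hj : j ∈ T := by_contra fun hj => hij.1.2 (hb j hj)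
    obtain ⟨rfl, rfl⟩ := h hi hj hij.2
    exact absurd rfl hne
  · simp only [Finset.mem_filter, Finset.mem_product, GradedRing.mem_support_iff, and_true,
      not_and_or, not_not] at hpq
    exact mul_eq_zero_of_ne_zero_imp_eq_zero hpq.resolve_left

variable [IsDomain B] [TwoUniqueSums Γ]

-- If `u * v = 1`, then a pair of degrees with a unique sum contributes to `1`, so has sum `0`. Two
-- such pairs would have the same sum, hence `u` and `v` are both homogeneous.
theorem exists_mem_of_isUnit {u : B} (hu : IsUnit u) : ∃ p, u ∈ 𝒜 p := by
  obtain ⟨v, huv⟩ := hu.exists_right_inv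
  obtain ⟨S, huS, hS⟩ := exists_finset_mem_supportedIn 𝒜 u
  obtain ⟨T, hvT, hT⟩ := exists_finset_mem_supportedIn 𝒜 v
  have hsum {r : Γ × Γ} (hr : r ∈ S ×ˢ T) (h : UniqueAdd S T r.1 r.2) : r.1 + r.2 = 0 := by
    by_contra hne
    obtain ⟨hp, hq⟩ := Finset.mem_product.1 hr
    have hmul := proj_mul_of_uniqueAdd 𝒜 huS hvT h
    rw [huv, proj_of_mem_ne 𝒜 SetLike.GradedOne.one_mem (Ne.symm hne)] at hmul
    exact mul_ne_zero (hS _ hp) (hT _ hq) hmul.symm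
  have hcard : S.card * T.card ≤ 1 := by
    by_contra! hlt
    obtain ⟨r, hr, r', hr', hne, h, h'⟩ := TwoUniqueSums.uniqueAdd_of_one_lt_card hlt
    obtain ⟨hp, hq⟩ := Finset.mem_product.1 hr
    exact hne (Prod.ext_iff.2 (h' hp hq ((hsum hr h).trans (hsum hr' h').symm)))
  have nonempty_of_mem {b : B} {U : Finset Γ} (hb : b ∈ supportedIn 𝒜 (U : Set Γ)) (hb0 : b ≠ 0) :
      U.Nonempty := by
    rw [Finset.nonempty_iff_ne_empty]
    rintro rfl
    exact hb0 (eq_zero_of_forall_proj_eq_zero 𝒜 fun i => hb i (by simp))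
  have hcardS := (nonempty_of_mem huS hu.ne_zero).card_pos
  have hcardT := (nonempty_of_mem hvT (right_ne_zero_of_mul_eq_one huv)).card_pos
  obtain ⟨p, rfl⟩ := Finset.card_eq_one.1 (show S.card = 1 by nlinarith)
  rw [Finset.coe_singleton, supportedIn_singleton] at huS
  exact ⟨p, huS⟩

theorem mem_zero_of_isUnit_of_isUnit_one_add {u : B} (hu : IsUnit u) (hu1 : IsUnit (1 + u)) :
    u ∈ 𝒜 0 := by
  obtain ⟨p, hp⟩ := exists_mem_of_isUnit 𝒜 hu
  obtain ⟨q, hq⟩ := exists_mem_of_isUnit 𝒜 hu1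
  by_contra hu0
  have hp0 : p ≠ 0 := fun h => hu0 (h ▸ hp)
  have hone : (1 : B) ∈ 𝒜 0 := SetLike.GradedOne.one_mem
  obtain rfl : q = 0 := by
    by_contra hq0
    have h := proj_of_mem_ne 𝒜 hq hq0
    rw [map_add, proj_of_mem 𝒜 hone, proj_of_mem_ne 𝒜 hp hp0, add_zero] at h
    exact one_ne_zero h
  exact hu0 (by simpa using sub_mem hq hone)

theorem algebraMap_mem_zero {k : Type*} [Field k] [Algebra k B] (c : k) :
    algebraMap k B c ∈ 𝒜 0 := by
  have hunit {c : k} (hc : c ≠ 0) : IsUnit (algebraMap k B c) :=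
    (IsUnit.mk0 c hc).map (algebraMap k B)
  rcases eq_or_ne c 0 with rfl | hc
  · simp only [map_zero, zero_mem]
  rcases eq_or_ne (1 + c) 0 with hc1 | hc1
  · rw [eq_neg_of_add_eq_zero_right hc1, map_neg, map_one]
    exact neg_mem SetLike.GradedOne.one_mem
  · exact mem_zero_of_isUnit_of_isUnit_one_add 𝒜 (hunit hc) (by simpa using hunit hc1)

end Support

section Component

variable [AddCommGroup Γ] [GradedRing 𝒜]

theorem derivation_ext_of_homogeneous {D E : Derivation ℤ B B}
    (h : ∀ i, ∀ b ∈ 𝒜 i, D b = E b) : D = E := by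
  ext b
  induction b using Decomposition.inductionOn 𝒜 with
  | zero => simp only [map_zero]
  | homogeneous b => exact h _ b b.2
  | add a b ha hb => rw [map_add, map_add, ha, hb]

theorem proj_mul_of_mem {i : Γ} {a : B} (ha : a ∈ 𝒜 i) (j : Γ) (b : B) :
    GradedRing.proj 𝒜 (i + j) (a * b) = a * GradedRing.proj 𝒜 j b :=
  coe_decompose_mul_add_of_left_mem 𝒜 ha

theorem mem_supportedIn_of_mul_mem [NoZeroDivisors B] {i : Γ} {a b : B} (ha : a ∈ 𝒜 i)
    (ha0 : a ≠ 0) {S T : Set Γ} (hT : ∀ j, i + j ∈ S → j ∈ T) (hab : a * b ∈ supportedIn 𝒜 S) :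
    b ∈ supportedIn 𝒜 T := fun j hj => by
  have hproj := hab (i + j) fun hS => hj (hT j hS)
  rw [proj_mul_of_mem 𝒜 ha] at hproj
  exact (mul_eq_zero_iff_left ha0).1 hproj

/-- The component of degree `j` of an additive endomorphism of a graded ring: it sends an element
`b` of degree `i` to the component of degree `i + j` of `f b`. -/
noncomputable def homogeneousComponentHom (f : B →+ B) (j : Γ) : B →+ B :=
  (toAddMonoid fun i => ((GradedRing.proj 𝒜 (i + j)).comp f).comp (𝒜 i).subtype).comp
    (decomposeAddEquiv 𝒜).toAddMonoidHom

theorem homogeneousComponentHom_of_mem (f : B →+ B) (j : Γ) {i : Γ} {b : B} (hb : b ∈ 𝒜 i) :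
    homogeneousComponentHom 𝒜 f j b = GradedRing.proj 𝒜 (i + j) (f b) := by
  simp [homogeneousComponentHom, decompose_of_mem 𝒜 hb]

theorem homogeneousComponentHom_leibniz (D : Derivation ℤ B B) (j : Γ) (a b : B) :
    homogeneousComponentHom 𝒜 (D : B →+ B) j (a * b) =
      a • homogeneousComponentHom 𝒜 (D : B →+ B) j b +
        b • homogeneousComponentHom 𝒜 (D : B →+ B) j a := by
  induction a using Decomposition.inductionOn 𝒜 with
  | zero => simp
  | add a a' h h' => simp only [add_mul, map_add, h, h', add_smul, smul_add]; abel
  | @homogeneous p a =>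
    induction b using Decomposition.inductionOn 𝒜 with
    | zero => simp
    | add b b' h h' => simp only [mul_add, map_add, h, h', add_smul, smul_add]; abel
    | @homogeneous q b =>
      rw [homogeneousComponentHom_of_mem 𝒜 _ j a.2, homogeneousComponentHom_of_mem 𝒜 _ j b.2,
        homogeneousComponentHom_of_mem 𝒜 _ j (SetLike.mul_mem_graded a.2 b.2), smul_eq_mul,
        smul_eq_mul, ← proj_mul_of_mem 𝒜 a.2, ← proj_mul_of_mem 𝒜 b.2, add_left_comm q,
        ← add_assoc p, ← map_add]
      exact congr_arg _ (D.leibniz _ _)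

/-- The homogeneous component of degree `j` of a derivation of a graded ring. For a locally
nilpotent derivation the nonzero component of highest degree, if there is one, is locally nilpotent
too. -/
noncomputable def derivationComponent (D : Derivation ℤ B B) (j : Γ) : Derivation ℤ B B :=
  Derivation.mk' (homogeneousComponentHom 𝒜 (D : B →+ B) j).toIntLinearMap
    (homogeneousComponentHom_leibniz 𝒜 D j)

theorem derivationComponent_of_mem (D : Derivation ℤ B B) (j : Γ) {i : Γ} {b : B}
    (hb : b ∈ 𝒜 i) : derivationComponent 𝒜 D j b = GradedRing.proj 𝒜 (i + j) (D b) :=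
  homogeneousComponentHom_of_mem 𝒜 _ j hb

/-- `D` is homogeneous of degree `e`: it maps `B_i` to `B_{i + e}` for all `i`. The zero derivation
is homogeneous of every degree. -/
def IsHomogeneousDerivation (D : Derivation ℤ B B) (e : Γ) : Prop :=
  ∀ i, ∀ b ∈ 𝒜 i, D b ∈ 𝒜 (i + e)

theorem isHomogeneousDerivation_derivationComponent (D : Derivation ℤ B B) (e : Γ) :
    IsHomogeneousDerivation 𝒜 (derivationComponent 𝒜 D e) e := fun i b hb => by
  rw [derivationComponent_of_mem 𝒜 D e hb]
  exact proj_mem 𝒜 _ _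

theorem exists_derivationComponent_ne_zero {D : Derivation ℤ B B} (hD : D ≠ 0) :
    ∃ j, derivationComponent 𝒜 D j ≠ 0 := by
  by_contra! h
  refine hD (derivation_ext_of_homogeneous 𝒜 fun i b hb => ?_)
  refine eq_zero_of_forall_proj_eq_zero 𝒜 fun l => ?_
  rw [← add_sub_cancel i l, ← derivationComponent_of_mem 𝒜 D _ hb, h, Derivation.zero_apply]

theorem isLocallyNilpotentDerivation_of_homogeneous {D : Derivation ℤ B B}
    (h : ∀ i, ∀ b ∈ 𝒜 i, ∃ m : ℕ, D^[m] b = 0) : IsLocallyNilpotentDerivation D := by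
  intro b
  induction b using Decomposition.inductionOn 𝒜 with
  | zero => exact ⟨0, rfl⟩
  | homogeneous b => exact h _ b b.2
  | add a b ha hb =>
    obtain ⟨m, hm⟩ := ha
    obtain ⟨n, hn⟩ := hb
    refine ⟨max m n, ?_⟩
    rw [iterate_map_add, iterate_eq_zero_of_le hm (le_max_left m n),
      iterate_eq_zero_of_le hn (le_max_right m n), add_zero]

section FiniteType

theorem finite_setOf_derivationComponent_apply_ne_zero (D : Derivation ℤ B B) (b : B) :
    {j | derivationComponent 𝒜 D j b ≠ 0}.Finite := by
  induction b using Decomposition.inductionOn 𝒜 with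
  | zero => simp only [map_zero, ne_eq, not_true_eq_false, Set.ofPred_false, Set.finite_empty]
  | @homogeneous i b =>
    obtain ⟨S, hS, -⟩ := exists_finset_mem_supportedIn 𝒜 (D b)
    refine (S.finite_toSet.preimage (add_right_injective i).injOn).subset fun j hj => ?_
    by_contra hjS
    exact hj ((derivationComponent_of_mem 𝒜 D j b.2).trans (hS _ hjS))
  | add a b ha hb =>
    refine (ha.union hb).subset fun j hj => ?_
    by_contra hne
    simp only [Set.mem_union, Set.mem_ofPred_eq, not_or, not_not] at hne
    exact hj (by rw [map_add, hne.1, hne.2, add_zero])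

theorem derivation_eq_zero_of_adjoin_eq_top {k A : Type*} [CommSemiring k] [CommRing A]
    [Algebra k A] {s : Set A} (hs : Algebra.adjoin k s = ⊤) {D : Derivation ℤ A A}
    (hk : ∀ c, D (algebraMap k A c) = 0) (h : ∀ a ∈ s, D a = 0) : D = 0 := by
  ext a
  have ha : a ∈ Algebra.adjoin k s := hs ▸ Algebra.mem_top
  induction ha using Algebra.adjoin_induction with
  | mem a ha => exact h a ha
  | algebraMap c => exact hk c
  | add a b _ _ ha hb => rw [map_add, ha, hb, map_add]
  | mul a b _ _ ha hb => simp [ha, hb]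

variable [TwoUniqueSums Γ] [IsDomain B] [CharZero B] (k : Type*) [Field k] [Algebra k B]

theorem IsLocallyNilpotentDerivation.derivationComponent_algebraMap {D : Derivation ℤ B B}
    (hD : IsLocallyNilpotentDerivation D) (j : Γ) (c : k) :
    derivationComponent 𝒜 D j (algebraMap k B c) = 0 := by
  rcases eq_or_ne c 0 with rfl | hc
  · simp only [map_zero]
  · rw [derivationComponent_of_mem 𝒜 D j (algebraMap_mem_zero 𝒜 c),
      hD.apply_eq_zero_of_isUnit ((IsUnit.mk0 c hc).map (algebraMap k B)), map_zero]

theorem IsLocallyNilpotentDerivation.finite_setOf_derivationComponent_ne_zero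
    [Algebra.FiniteType k B] {D : Derivation ℤ B B} (hD : IsLocallyNilpotentDerivation D) :
    {j | derivationComponent 𝒜 D j ≠ 0}.Finite := by
  obtain ⟨S, hS⟩ := (Algebra.FiniteType.out : (⊤ : Subalgebra k B).FG)
  refine (S.finite_toSet.biUnion fun b _ =>
    finite_setOf_derivationComponent_apply_ne_zero 𝒜 D b).subset fun j hj => ?_
  by_contra hjS
  simp only [Set.mem_iUnion, Set.mem_ofPred_eq, not_exists, not_not] at hjS
  exact hj (derivation_eq_zero_of_adjoin_eq_top hS
    (hD.derivationComponent_algebraMap 𝒜 k j) hjS)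

end FiniteType

section TopComponent

variable [LinearOrder Γ] [IsOrderedAddMonoid Γ] {D : Derivation ℤ B B} {e : Γ}

open Set (Iic)

theorem derivation_mem_supportedIn_Iic (he : ∀ j, e < j → derivationComponent 𝒜 D j = 0) {l : Γ}
    {b : B} (hb : b ∈ supportedIn 𝒜 (Iic l)) : D b ∈ supportedIn 𝒜 (Iic (l + e)) := by
  have hle : supportedIn 𝒜 (Iic l) ≤ (supportedIn 𝒜 (Iic (l + e))).comap (D : B →+ B) := by
    refine supportedIn_le 𝒜 fun i hi b hb t ht => ?_
    have het : e < t - i := lt_sub_iff_add_lt'.2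
      ((add_le_add_left (Set.mem_Iic.1 hi) e).trans_lt (not_le.1 ht))
    have h := derivationComponent_of_mem 𝒜 D (t - i) hb
    rw [he _ het, add_sub_cancel] at h
    exact h.symm
  exact hle hb

theorem proj_derivation_of_mem_supportedIn_Iic (he : ∀ j, e < j → derivationComponent 𝒜 D j = 0)
    {l : Γ} {b : B} (hb : b ∈ supportedIn 𝒜 (Iic l)) :
    GradedRing.proj 𝒜 (l + e) (D b) = derivationComponent 𝒜 D e (GradedRing.proj 𝒜 l b) := by
  have hle : supportedIn 𝒜 (Iic l) ≤ ((GradedRing.proj 𝒜 (l + e)).comp (D : B →+ B)).eqLocus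
      ((derivationComponent 𝒜 D e : B →+ B).comp (GradedRing.proj 𝒜 l)) := by
    refine supportedIn_le 𝒜 fun i hi c hc => ?_
    change GradedRing.proj 𝒜 (l + e) (D c) = derivationComponent 𝒜 D e (GradedRing.proj 𝒜 l c)
    rcases (Set.mem_Iic.1 hi).eq_or_lt with rfl | hil
    · rw [proj_of_mem 𝒜 hc, derivationComponent_of_mem 𝒜 D e hc]
    · have hmem := derivation_mem_supportedIn_Iic 𝒜 he (le_supportedIn 𝒜 Set.self_mem_Iic hc)
      rw [proj_of_mem_ne 𝒜 hc hil.ne, map_zero]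
      exact hmem _ (not_le.2 (add_lt_add_left hil e))
  exact hle hb

theorem iterate_derivationComponent (he : ∀ j, e < j → derivationComponent 𝒜 D j = 0) {l : Γ}
    {b : B} (hb : b ∈ supportedIn 𝒜 (Iic l)) (m : ℕ) :
    D^[m] b ∈ supportedIn 𝒜 (Iic (l + m • e)) ∧ GradedRing.proj 𝒜 (l + m • e) (D^[m] b) =
      (derivationComponent 𝒜 D e)^[m] (GradedRing.proj 𝒜 l b) := by
  induction m with
  | zero => simpa using hb
  | succ m ih =>
    rw [succ_nsmul, ← add_assoc]
    simp only [Function.iterate_succ_apply', ← ih.2]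
    exact ⟨derivation_mem_supportedIn_Iic 𝒜 he ih.1,
      proj_derivation_of_mem_supportedIn_Iic 𝒜 he ih.1⟩

theorem isLocallyNilpotentDerivation_derivationComponent (hD : IsLocallyNilpotentDerivation D)
    (he : ∀ j, e < j → derivationComponent 𝒜 D j = 0) :
    IsLocallyNilpotentDerivation (derivationComponent 𝒜 D e) := by
  refine isLocallyNilpotentDerivation_of_homogeneous 𝒜 fun i b hb => (hD b).imp fun m hm => ?_
  have h := (iterate_derivationComponent 𝒜 he (le_supportedIn 𝒜 Set.self_mem_Iic hb) m).2
  rwa [hm, map_zero, proj_of_mem 𝒜 hb, eq_comm] at h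

theorem exists_homogeneous_of_not_isRigidRing (k : Type*) [Field k] [Algebra k B] [IsDomain B]
    [CharZero B] [Algebra.FiniteType k B] (h : ¬ IsRigidRing B) :
    ∃ (D : Derivation ℤ B B) (e : Γ),
      IsLocallyNilpotentDerivation D ∧ D ≠ 0 ∧ IsHomogeneousDerivation 𝒜 D e := by
  simp only [IsRigidRing, not_forall] at h
  obtain ⟨D, hD, hne⟩ := h
  obtain ⟨e, he, hmax⟩ := Set.exists_max_image _ id
    (hD.finite_setOf_derivationComponent_ne_zero 𝒜 k) (exists_derivationComponent_ne_zero 𝒜 hne)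
  have hzero (j : Γ) (hj : e < j) : derivationComponent 𝒜 D j = 0 :=
    by_contra fun hj0 => (hmax j hj0).not_gt hj
  exact ⟨derivationComponent 𝒜 D e, e,
    isLocallyNilpotentDerivation_derivationComponent 𝒜 hD hzero, he,
    isHomogeneousDerivation_derivationComponent 𝒜 D e⟩

end TopComponent

end Component

section LocalSlice

theorem iterate_localSlice_mul {D : Derivation ℤ B B} {s : B} (hs : D (D s) = 0) (n : ℕ) (b : B) :
    D^[n + 1] (s * b) = s * D^[n + 1] b + (n + 1) • (D s * D^[n] b) := by
  induction n with
  | zero => simp [mul_comm]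
  | succ n ih =>
    rw [Function.iterate_succ_apply', ih, map_add, map_nsmul, D.leibniz, D.leibniz, hs]
    simp only [Function.iterate_succ_apply', smul_eq_mul, mul_zero, add_zero, nsmul_eq_mul,
      Nat.cast_add, Nat.cast_one]
    ring

theorem iterate_localSlice_reduction_eq_zero {D : Derivation ℤ B B} {s b : B} (hs : D (D s) = 0)
    {m : ℕ} (hb : D^[m + 2] b = 0) : D^[m + 1] ((m + 1) • (D s * b) - s * D b) = 0 := by
  rw [iterate_map_sub, iterate_map_nsmul, iterate_mul_of_apply_eq_zero hs,
    iterate_localSlice_mul hs, ← Function.iterate_succ_apply, ← Function.iterate_succ_apply, hb]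
  simp only [mul_zero, zero_add, sub_self]

variable [AddCommGroup Γ] [GradedRing 𝒜] {D : Derivation ℤ B B} {e : Γ}

theorem exists_homogeneous_localSlice (hD : IsLocallyNilpotentDerivation D) (hne : D ≠ 0)
    (hhom : IsHomogeneousDerivation 𝒜 D e) : ∃ p, ∃ s ∈ 𝒜 p, HasNilDegree D s 1 := by
  obtain ⟨i, b, hb, hDb⟩ : ∃ i, ∃ b ∈ 𝒜 i, D b ≠ 0 := by
    by_contra! h
    exact hne (derivation_ext_of_homogeneous 𝒜 h)
  have hiter (n : ℕ) : D^[n] b ∈ 𝒜 (i + n • e) := by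
    induction n with
    | zero => simpa using hb
    | succ n ih =>
      rw [Function.iterate_succ_apply', succ_nsmul, ← add_assoc]
      exact hhom _ _ ih
  obtain ⟨m, hm⟩ := exists_hasNilDegree (hD (D b)) hDb
  refine ⟨_, _, hiter m, ?_⟩
  rw [HasNilDegree, ← Function.iterate_add_apply, ← Function.iterate_add_apply, add_comm,
    add_comm (1 + 1)]
  exact hm

variable [IsDomain B] [CharZero B]

theorem exists_kernel_localSlice_dvd_sub (hhom : IsHomogeneousDerivation 𝒜 D e) {p : Γ} {s : B}
    (hsp : s ∈ 𝒜 p) (hs : HasNilDegree D s 1) (m : ℕ) {i : Γ} {b : B} (hb : b ∈ 𝒜 i)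
    (hm : D^[m + 1] b = 0) :
    ∃ (n : ℕ) (a f : B), a ≠ 0 ∧ D a = 0 ∧ f ∈ 𝒜 (n • (p + e) + i) ∧ D f = 0 ∧
      s ∣ a * b - f := by
  induction m generalizing i b with
  | zero => exact ⟨0, 1, b, one_ne_zero, D.map_one_eq_zero, by simpa using hb, hm, by simp⟩
  | succ m ih =>
    have hmem : (m + 1) • (D s * b) - s * D b ∈ 𝒜 (p + e + i) := by
      refine sub_mem (nsmul_mem (SetLike.mul_mem_graded (hhom p s hsp) hb) _) ?_
      rw [add_assoc, add_comm e]
      exact SetLike.mul_mem_graded hsp (hhom i b hb)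
    obtain ⟨n, a, f, ha, hDa, hf, hDf, hdvd⟩ :=
      ih hmem (iterate_localSlice_reduction_eq_zero hs.2 hm)
    refine ⟨n + 1, a * ((m + 1) • D s), f, mul_ne_zero ha (smul_ne_zero m.succ_ne_zero hs.1), ?_,
      by rwa [succ_nsmul, add_assoc], hDf, ?_⟩
    · have hDDs : D (D s) = 0 := hs.2
      rw [D.leibniz, map_nsmul, hDa, hDDs, smul_zero, smul_zero, smul_zero, add_zero]
    · have hsplit : a * ((m + 1) • D s) * b - f =
          a * ((m + 1) • (D s * b) - s * D b) - f + s * (a * D b) := by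
        simp only [nsmul_eq_mul]
        ring
      exact hsplit ▸ dvd_add hdvd (dvd_mul_right s _)

theorem dvd_localSlice_of_notMem_degreeSubgroup (hD : IsLocallyNilpotentDerivation D)
    (hhom : IsHomogeneousDerivation 𝒜 D e) {p : Γ} {s : B} (hsp : s ∈ 𝒜 p)
    (hs : HasNilDegree D s 1) {i : Γ} {z : B} (hz : z ∈ 𝒜 i) (hzp : Prime z)
    (hi : i ∉ degreeSubgroup 𝒜 (kernelSubmonoid D)) : z ∣ s := by
  obtain ⟨m, hm⟩ := exists_hasNilDegree (hD z) hzp.ne_zero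
  obtain ⟨n, a, f, ha, hDa, hf, hDf, hdvd⟩ :=
    exists_kernel_localSlice_dvd_sub 𝒜 hhom hsp hs m hz hm.2
  have hDs : p + e ∈ degreeSubgroup 𝒜 (kernelSubmonoid D) :=
    mem_degreeSubgroup 𝒜 (M := kernelSubmonoid D) hs (hhom p s hsp)
  obtain rfl : f = 0 := by
    by_contra hf0
    exact hi ((AddSubgroup.add_mem_cancel_left _ (nsmul_mem hDs n)).1
      (mem_degreeSubgroup 𝒜 (M := kernelSubmonoid D) ⟨hf0, hDf⟩ hf))
  obtain ⟨c, hc⟩ := hdvd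
  rw [sub_zero] at hc
  refine (hzp.dvd_or_dvd (Dvd.intro_left a hc)).resolve_right ?_
  rintro ⟨c, rfl⟩
  have hsa : s ∣ a := ⟨c, mul_right_cancel₀ hzp.ne_zero (by rw [hc]; ring)⟩
  exact hs.1 (hD.apply_eq_zero_of_dvd hsa ha hDa)

theorem mem_degreeSubgroup_kernel_or_mem (hD : IsLocallyNilpotentDerivation D) (hne : D ≠ 0)
    (hhom : IsHomogeneousDerivation 𝒜 D e) {i j : Γ} {x y : B} (hx : x ∈ 𝒜 i) (hy : y ∈ 𝒜 j)
    (hxp : Prime x) (hyp : Prime y) (hxy : ¬ Associated x y) :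
    i ∈ degreeSubgroup 𝒜 (kernelSubmonoid D) ∨ j ∈ degreeSubgroup 𝒜 (kernelSubmonoid D) := by
  by_contra! h
  obtain ⟨p, s, hsp, hs⟩ := exists_homogeneous_localSlice 𝒜 hD hne hhom
  obtain ⟨w, rfl⟩ := dvd_localSlice_of_notMem_degreeSubgroup 𝒜 hD hhom hsp hs hx hxp h.1
  have hyw : y ∣ w :=
    (hyp.dvd_or_dvd (dvd_localSlice_of_notMem_degreeSubgroup 𝒜 hD hhom hsp hs hy hyp h.2)
      ).resolve_left fun hyx => hxy ((hyp.dvd_prime_iff_associated hxp).1 hyx).symm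
  rcases hD.apply_eq_zero_of_mul_dvd hs (mul_dvd_mul_left x hyw) with hDx | hDy
  · exact h.1 (mem_degreeSubgroup 𝒜 (M := kernelSubmonoid D) ⟨hxp.ne_zero, hDx⟩ hx)
  · exact h.2 (mem_degreeSubgroup 𝒜 (M := kernelSubmonoid D) ⟨hyp.ne_zero, hDy⟩ hy)

end LocalSlice

end Graded

theorem addSubgroup_eq_top_of_gcd_eq_one {κ : Type*} {G : AddSubgroup ℤ} {s : Finset κ}
    {δ : κ → ℤ} (hgcd : s.gcd δ = 1) (hmem : ∀ j ∈ s, δ j ∈ G) : G = ⊤ := by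
  obtain ⟨c, hc⟩ := Finset.gcd_eq_sum_mul s δ
  refine (AddSubgroup.eq_top_iff' G).2 fun t => ?_
  rw [← mul_one t, ← hgcd, hc, ← smul_eq_mul]
  refine zsmul_mem (sum_mem fun j hj => ?_) t
  rw [mul_comm, ← smul_eq_mul]
  exact zsmul_mem (hmem j hj) _

section Veronese

open DirectSum

variable {B : Type*} [CommRing B] (𝒜 : ℤ → AddSubgroup B) [GradedRing 𝒜] {d : ℕ}

-- Modulo `d`, the inverse of the degree of `u` is the degree of `u ^ (d - 1)`.
theorem exists_mem_of_mem_degreeSubgroup [NeZero d] {M : Submonoid B} {t : ℤ}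
    (ht : t ∈ degreeSubgroup 𝒜 M) : ∃ u ∈ M, ∃ s, u ∈ 𝒜 s ∧ (s : ZMod d) = t := by
  induction ht using AddSubgroup.closure_induction with
  | mem t ht =>
    obtain ⟨u, hu, ht⟩ := ht
    exact ⟨u, hu, t, ht, rfl⟩
  | zero => exact ⟨1, M.one_mem, 0, SetLike.GradedOne.one_mem, rfl⟩
  | add t t' _ _ h h' =>
    obtain ⟨u, hu, s, hs, hst⟩ := h
    obtain ⟨u', hu', s', hs', hst'⟩ := h'
    exact ⟨u * u', M.mul_mem hu hu', s + s', SetLike.mul_mem_graded hs hs', by simp [hst, hst']⟩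
  | neg t _ h =>
    obtain ⟨u, hu, s, hs, hst⟩ := h
    refine ⟨u ^ (d - 1), M.pow_mem hu _, _, SetLike.pow_mem_graded _ hs, ?_⟩
    simp [Nat.cast_sub (NeZero.one_le (n := d)), hst]

/-- The components of the `ZMod d`-grading obtained by reducing the degrees of a `ℤ`-grading modulo
`d`. The component of degree `0` is the Veronese subring. -/
def residueComponent (d : ℕ) (r : ZMod d) : AddSubgroup B :=
  supportedIn 𝒜 {i : ℤ | (i : ZMod d) = r}

theorem mem_residueComponent {i : ℤ} {b : B} (hb : b ∈ 𝒜 i) {r : ZMod d} (hi : (i : ZMod d) = r) :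
    b ∈ residueComponent 𝒜 d r :=
  le_supportedIn 𝒜 (S := {i : ℤ | (i : ZMod d) = r}) hi hb

instance residueComponent.gradedMonoid : SetLike.GradedMonoid (residueComponent 𝒜 d) where
  one_mem := mem_residueComponent 𝒜 SetLike.GradedOne.one_mem Int.cast_zero
  mul_mem _ _ _ _ := mul_mem_supportedIn 𝒜 fun i hi j hj =>
    (Int.cast_add i j).trans (congr_arg₂ (· + ·) hi hj)

theorem mem_veroneseSubring_iff {b : B} :
    b ∈ veroneseSubring 𝒜 d ↔ b ∈ residueComponent 𝒜 d 0 :=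
  forall_congr' fun i => by
    rw [Set.mem_ofPred_eq, ZMod.intCast_zmod_eq_zero_iff_dvd]

theorem pow_mem_veroneseSubring {r : ZMod d} {b : B} (hb : b ∈ residueComponent 𝒜 d r) :
    b ^ d ∈ veroneseSubring 𝒜 d := by
  rw [mem_veroneseSubring_iff]
  simpa using SetLike.pow_mem_graded d hb

theorem IsHomogeneousDerivation.residueComponent {D : Derivation ℤ B B} {e : ℤ}
    (hD : IsHomogeneousDerivation 𝒜 D e) :
    IsHomogeneousDerivation (residueComponent 𝒜 d) D (e : ZMod d) := fun r _ hb =>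
  supportedIn_le 𝒜 (T := (_root_.residueComponent 𝒜 d (r + e)).comap (D : B →+ B))
    (fun i hi b hb => mem_residueComponent 𝒜 (hD i b hb) (by rw [Int.cast_add, hi])) hb

variable [NeZero d] [IsDomain B] [CharZero B] {D : Derivation ℤ B B} {e : ℤ}

theorem derivation_eq_zero_of_forall_mem_veroneseSubring
    (h : ∀ b ∈ veroneseSubring 𝒜 d, D b = 0) : D = 0 := by
  refine derivation_ext_of_homogeneous 𝒜 fun i b hb => ?_
  rcases eq_or_ne b 0 with rfl | hb0
  · rw [map_zero, map_zero]
  have hpow := mul_derivation_pow D b d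
  rw [h _ (pow_mem_veroneseSubring 𝒜 (mem_residueComponent 𝒜 hb rfl)), mul_zero, eq_comm,
    smul_eq_zero_iff_right (NeZero.ne d)] at hpow
  exact (mul_eq_zero_iff_left (pow_ne_zero d hb0)).1 hpow

theorem not_isRigidRing_veroneseSubring_of_homogeneous (hD : IsLocallyNilpotentDerivation D)
    (hne : D ≠ 0) (hhom : IsHomogeneousDerivation 𝒜 D e) (he : (e : ZMod d) = 0) :
    ¬ IsRigidRing (veroneseSubring 𝒜 d) := by
  intro hrigid
  obtain ⟨D', hD'⟩ := exists_derivation_semiconj (A := veroneseSubring 𝒜 d) D fun a => by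
    have hmem := hhom.residueComponent 𝒜 0 a ((mem_veroneseSubring_iff 𝒜).1 a.2)
    rw [he, add_zero, ← mem_veroneseSubring_iff] at hmem
    exact ⟨⟨_, hmem⟩, rfl⟩
  refine hne (derivation_eq_zero_of_forall_mem_veroneseSubring 𝒜 (d := d) fun b hb => ?_)
  have hDb := hD' ⟨b, hb⟩
  rw [hrigid D' (hD.of_semiconj hD')] at hDb
  exact hDb.symm

theorem not_isRigidRing_veroneseSubring_of_degreeSubgroup_eq_top
    (hD : IsLocallyNilpotentDerivation D) (hne : D ≠ 0) (hhom : IsHomogeneousDerivation 𝒜 D e)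
    (htop : degreeSubgroup 𝒜 (kernelSubmonoid D) = ⊤) : ¬ IsRigidRing (veroneseSubring 𝒜 d) := by
  obtain ⟨f, ⟨hf0, hf⟩, s, hs, hse⟩ :=
    exists_mem_of_mem_degreeSubgroup 𝒜 (d := d) (htop ▸ AddSubgroup.mem_top (-e))
  refine not_isRigidRing_veroneseSubring_of_homogeneous 𝒜 (D := f • D) (e := s + e)
    (hD.smul hf) (smul_derivation_ne_zero hf0 hne) (fun i b hb => ?_) (by simp [hse])
  rw [add_left_comm]
  exact SetLike.mul_mem_graded hs (hhom i b hb)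

end Veronese

section Ascent

variable {B κ : Type*} [CommRing B] (𝒜 : ℤ → AddSubgroup B) [Fintype κ] [DecidableEq κ]
  {x : κ → B} {δ : κ → ℤ}

theorem degreeSubgroup_eq_top_of_gcd_eq_one (hhom : ∀ i, x i ∈ 𝒜 (δ i)) {i : κ}
    (hgcd : (Finset.univ.erase i).gcd δ = 1) :
    degreeSubgroup 𝒜 (Submonoid.closure (x '' {i}ᶜ)) = ⊤ :=
  addSubgroup_eq_top_of_gcd_eq_one hgcd fun j hj =>
    mem_degreeSubgroup 𝒜
      (Submonoid.subset_closure (Set.mem_image_of_mem x (Finset.ne_of_mem_erase hj))) (hhom j)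

variable [GradedRing 𝒜] [IsDomain B] [CharZero B] [Nonempty κ]

theorem degreeSubgroup_kernelSubmonoid_eq_top {D : Derivation ℤ B B} {e : ℤ}
    (hD : IsLocallyNilpotentDerivation D) (hne : D ≠ 0) (hDhom : IsHomogeneousDerivation 𝒜 D e)
    (hprime : ∀ i, Prime (x i)) (hhom : ∀ i, x i ∈ 𝒜 (δ i))
    (hgcd : ∀ i, (Finset.univ.erase i).gcd δ = 1)
    (hassoc : ∀ i j, i ≠ j → ¬ Associated (x i) (x j)) :
    degreeSubgroup 𝒜 (kernelSubmonoid D) = ⊤ := by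
  obtain ⟨i, hi⟩ : ∃ i, ∀ j ≠ i, δ j ∈ degreeSubgroup 𝒜 (kernelSubmonoid D) := by
    by_contra! hout
    obtain ⟨i, -, hi⟩ := hout (Classical.arbitrary κ)
    obtain ⟨j, hji, hj⟩ := hout i
    exact (mem_degreeSubgroup_kernel_or_mem 𝒜 hD hne hDhom (hhom i) (hhom j) (hprime i) (hprime j)
      (hassoc i j hji.symm)).elim hi hj
  exact addSubgroup_eq_top_of_gcd_eq_one (hgcd i) fun j hj => hi j (Finset.ne_of_mem_erase hj)

theorem not_isRigidRing_veroneseSubring_of_not_isRigidRing (k : Type*) [Field k] [Algebra k B]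
    [Algebra.FiniteType k B] (hprime : ∀ i, Prime (x i)) (hhom : ∀ i, x i ∈ 𝒜 (δ i))
    (hgcd : ∀ i, (Finset.univ.erase i).gcd δ = 1)
    (hassoc : ∀ i j, i ≠ j → ¬ Associated (x i) (x j)) (d : ℕ) [NeZero d] (h : ¬ IsRigidRing B) :
    ¬ IsRigidRing (veroneseSubring 𝒜 d) := by
  obtain ⟨D, e, hD, hne, hDhom⟩ := exists_homogeneous_of_not_isRigidRing 𝒜 k h
  exact not_isRigidRing_veroneseSubring_of_degreeSubgroup_eq_top 𝒜 hD hne hDhom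
    (degreeSubgroup_kernelSubmonoid_eq_top 𝒜 hD hne hDhom hprime hhom hgcd hassoc)

end Ascent

section PrimeDenominators

theorem not_dvd_of_mem_closure {M κ : Type*} [CommMonoidWithZero M] [IsCancelMulZero M] {x : κ → M}
    (hprime : ∀ i, Prime (x i)) (hassoc : ∀ i j, i ≠ j → ¬ Associated (x i) (x j)) {i : κ} {u : M}
    (hu : u ∈ Submonoid.closure (x '' {i}ᶜ)) : ¬ x i ∣ u := by
  induction hu using Submonoid.closure_induction with
  | mem u hu =>
    obtain ⟨j, hj, rfl⟩ := hu
    exact fun h => hassoc i j (Ne.symm hj) (((hprime i).dvd_prime_iff_associated (hprime j)).1 h)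
  | one => exact (hprime i).not_dvd_one
  | mul a b _ _ ha hb => exact fun h => ((hprime i).dvd_or_dvd h).elim ha hb

theorem dvd_of_forall_prime {M : Type*} [CommMonoidWithZero M] [IsCancelMulZero M] {P : Set M}
    (hP : ∀ p ∈ P, Prime p) {u w : M} (hu : u ∈ Submonoid.closure P)
    (h : ∀ p ∈ P, ∃ v, ¬ p ∣ v ∧ u ∣ v * w) : u ∣ w := by
  induction hu using Submonoid.closure_induction generalizing w with
  | mem p hp =>
    obtain ⟨v, hpv, hpvw⟩ := h p hp
    exact ((hP p hp).dvd_or_dvd hpvw).resolve_left hpv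
  | one => exact one_dvd w
  | mul a b _ _ ha hb =>
    obtain ⟨c, rfl⟩ := ha fun p hp => (h p hp).imp fun v hv => hv.imp_right dvd_of_mul_right_dvd
    rcases eq_or_ne a 0 with rfl | ha0
    · simp only [zero_mul, dvd_refl]
    refine mul_dvd_mul_left a (hb fun p hp => (h p hp).imp fun v hv => hv.imp_right fun hdvd => ?_)
    rwa [mul_left_comm, mul_dvd_mul_iff_left ha0] at hdvd

theorem mem_range_algebraMap_of_forall_prime {B L : Type*} [CommRing B] [IsDomain B] [CommRing L]
    [IsDomain L] [Algebra B L] [FaithfulSMul B L] {P : Set B} (hP : ∀ p ∈ P, Prime p) {z : L}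
    {u : B} (hu : u ∈ Submonoid.closure P) (huz : u • z ∈ (algebraMap B L).range)
    (h : ∀ p ∈ P, ∃ v, ¬ p ∣ v ∧ v • z ∈ (algebraMap B L).range) :
    z ∈ (algebraMap B L).range := by
  have hinj : Function.Injective (algebraMap B L) := FaithfulSMul.algebraMap_injective B L
  obtain ⟨w, hw⟩ := huz
  obtain ⟨y, rfl⟩ : u ∣ w := dvd_of_forall_prime hP hu fun p hp => by
    obtain ⟨v, hpv, c, hc⟩ := h p hp
    refine ⟨v, hpv, c, hinj ?_⟩
    rw [map_mul, map_mul, hw, hc, Algebra.smul_def, Algebra.smul_def, mul_left_comm]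
  have hu0 : u ≠ 0 := nonZeroDivisors.ne_zero <|
    Submonoid.closure_le.2 (fun p hp => mem_nonZeroDivisors_of_ne_zero (hP p hp).ne_zero) hu
  refine ⟨y, mul_left_cancel₀ ((map_ne_zero_iff _ hinj).2 hu0) ?_⟩
  rw [← map_mul, hw, Algebra.smul_def]

end PrimeDenominators

section Descent

open DirectSum
open Function (Semiconj)

variable {B : Type*} [CommRing B] {𝒜 : ℤ → AddSubgroup B} [GradedRing 𝒜] {d : ℕ}

-- `u ^ (d + 1) * d * E b = d * u ^ d * D (u * b) - b * u * D (u ^ d)`.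
theorem pow_smul_nsmul_mem_range {L : Type*} [CommRing L] [Algebra B L] {E : Derivation ℤ L L}
    {D : Derivation ℤ (veroneseSubring 𝒜 d) (veroneseSubring 𝒜 d)}
    (hDE : Semiconj (algebraMap (veroneseSubring 𝒜 d) L) D E) {r s : ℤ} {b u : B} (hb : b ∈ 𝒜 r)
    (hu : u ∈ 𝒜 s) (hsr : (s : ZMod d) = (-r : ℤ)) :
    u ^ (d + 1) • d • E (algebraMap B L b) ∈ (algebraMap B L).range := by
  have hub : u * b ∈ veroneseSubring 𝒜 d := (mem_veroneseSubring_iff 𝒜).2 <|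
    mem_residueComponent 𝒜 (SetLike.mul_mem_graded hu hb) (by simp [hsr])
  have hud : u ^ d ∈ veroneseSubring 𝒜 d :=
    pow_mem_veroneseSubring 𝒜 (mem_residueComponent 𝒜 hu rfl)
  have hEub : algebraMap B L (D ⟨_, hub⟩) = E (algebraMap B L (u * b)) := hDE ⟨_, hub⟩
  have hEud : algebraMap B L (D ⟨_, hud⟩) = E (algebraMap B L (u ^ d)) := hDE ⟨_, hud⟩
  refine ⟨d * u ^ d * D ⟨_, hub⟩ - b * u * D ⟨_, hud⟩, ?_⟩
  have hpow := mul_derivation_pow E (algebraMap B L u) d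
  rw [map_sub, map_mul, map_mul _ (b * u), hEub, hEud, map_mul _ u, E.leibniz]
  simp only [map_mul, map_pow, map_natCast, Algebra.smul_def] at hpow ⊢
  linear_combination -algebraMap B L b * hpow

variable [NeZero d]

variable (𝒜 d) in
theorem isIntegral_veroneseSubring : Algebra.IsIntegral (veroneseSubring 𝒜 d) B where
  isIntegral b := by
    induction b using Decomposition.inductionOn 𝒜 with
    | zero => exact isIntegral_zero
    | add a b ha hb => exact ha.add hb
    | homogeneous b =>
      have hpow := pow_mem_veroneseSubring 𝒜 (d := d) (mem_residueComponent 𝒜 b.2 rfl)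
      exact IsIntegral.of_pow (Nat.pos_of_neZero d)
        (isIntegral_algebraMap (x := (⟨_, hpow⟩ : veroneseSubring 𝒜 d)))

variable [IsDomain B]

section Extension

variable {κ : Type*} [Fintype κ] [DecidableEq κ] [Nonempty κ] {x : κ → B} {δ : κ → ℤ}

theorem nsmul_mem_range {L : Type*} [CommRing L] [IsDomain L] [Algebra B L] [FaithfulSMul B L]
    {D : Derivation ℤ (veroneseSubring 𝒜 d) (veroneseSubring 𝒜 d)} {E : Derivation ℤ L L}
    (hDE : Semiconj (algebraMap (veroneseSubring 𝒜 d) L) D E) (hprime : ∀ i, Prime (x i))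
    (hhom : ∀ i, x i ∈ 𝒜 (δ i)) (hgcd : ∀ i, (Finset.univ.erase i).gcd δ = 1)
    (hassoc : ∀ i j, i ≠ j → ¬ Associated (x i) (x j)) (b : B) :
    d • E (algebraMap B L b) ∈ (algebraMap B L).range := by
  induction b using Decomposition.inductionOn 𝒜 with
  | zero => simp only [map_zero, smul_zero, zero_mem]
  | add a b ha hb => simpa only [map_add, smul_add] using add_mem ha hb
  | @homogeneous r b =>
    have hden (i : κ) : ∃ u ∈ Submonoid.closure (x '' {i}ᶜ),
        u • d • E (algebraMap B L b) ∈ (algebraMap B L).range := by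
      obtain ⟨u, hu, s, hs, hsr⟩ := exists_mem_of_mem_degreeSubgroup 𝒜 (d := d)
        (degreeSubgroup_eq_top_of_gcd_eq_one 𝒜 hhom (hgcd i) ▸ AddSubgroup.mem_top (-r))
      exact ⟨u ^ (d + 1), pow_mem hu _, pow_smul_nsmul_mem_range hDE b.2 hs hsr⟩
    obtain ⟨u, hu, huz⟩ := hden (Classical.arbitrary κ)
    refine mem_range_algebraMap_of_forall_prime (P := Set.range x) (Set.forall_mem_range.2 hprime)
      (Submonoid.closure_mono (Set.image_subset_range x _) hu) huz
      (Set.forall_mem_range.2 fun i => ?_)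
    obtain ⟨v, hv, hvz⟩ := hden i
    exact ⟨v, not_dvd_of_mem_closure hprime hassoc hv, hvz⟩

variable [CharZero B]

theorem exists_derivation_fractionField_semiconj (L : Type*) [Field L] [Algebra B L]
    [IsFractionRing B L] (D : Derivation ℤ (veroneseSubring 𝒜 d) (veroneseSubring 𝒜 d)) :
    ∃ E : Derivation ℤ L L, Semiconj (algebraMap (veroneseSubring 𝒜 d) L) D E := by
  have := isIntegral_veroneseSubring 𝒜 d
  have : Algebra.IsAlgebraic B L := IsLocalization.isAlgebraic L (nonZeroDivisors B)
  have : Algebra.IsAlgebraic (veroneseSubring 𝒜 d) L := Algebra.IsAlgebraic.trans _ B L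
  exact exists_derivation_extend_of_isAlgebraic D

theorem exists_derivation_semiconj_natCast_smul
    (D : Derivation ℤ (veroneseSubring 𝒜 d) (veroneseSubring 𝒜 d)) (hprime : ∀ i, Prime (x i))
    (hhom : ∀ i, x i ∈ 𝒜 (δ i)) (hgcd : ∀ i, (Finset.univ.erase i).gcd δ = 1)
    (hassoc : ∀ i j, i ≠ j → ¬ Associated (x i) (x j)) :
    ∃ F : Derivation ℤ B B,
      Semiconj (algebraMap (veroneseSubring 𝒜 d) B) ⇑((d : veroneseSubring 𝒜 d) • D) F := by
  obtain ⟨E, hDE⟩ := exists_derivation_fractionField_semiconj (FractionRing B) D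
  obtain ⟨F, hF⟩ := exists_derivation_semiconj (A := B) (d • E)
    (nsmul_mem_range hDE hprime hhom hgcd hassoc)
  refine ⟨F, fun a => IsFractionRing.injective B (FractionRing B) ?_⟩
  have hDa : algebraMap B (FractionRing B) (D a) = E (algebraMap B (FractionRing B) a) := hDE a
  calc algebraMap B (FractionRing B) (((d : veroneseSubring 𝒜 d) • D) a : veroneseSubring 𝒜 d)
      = d • algebraMap B (FractionRing B) (D a) := by simp
    _ = algebraMap B (FractionRing B) (F a) := by rw [hDa]; exact (hF a).symm

end Extension

variable [CharZero B] {F : Derivation ℤ B B}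

theorem isHomogeneousDerivation_residueComponent_zero
    (hF : ∀ b ∈ veroneseSubring 𝒜 d, F b ∈ veroneseSubring 𝒜 d) :
    IsHomogeneousDerivation (residueComponent 𝒜 d) F 0 := by
  have hhom (i : ℤ) (b : B) (hb : b ∈ 𝒜 i) : F b ∈ residueComponent 𝒜 d i := by
    rcases eq_or_ne b 0 with rfl | hb0
    · simp only [map_zero, zero_mem]
    have hpow := hF _ (pow_mem_veroneseSubring 𝒜 (mem_residueComponent 𝒜 hb rfl))
    have hmul := SetLike.mul_mem_graded (mem_residueComponent 𝒜 (d := d) hb rfl)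
      ((mem_veroneseSubring_iff 𝒜).1 hpow)
    rw [mul_derivation_pow, ← smul_mul_assoc, add_zero] at hmul
    exact mem_supportedIn_of_mul_mem 𝒜 (nsmul_mem (SetLike.pow_mem_graded d hb) d)
      (smul_ne_zero (NeZero.ne d) (pow_ne_zero d hb0)) (fun j hj => by simpa using hj) hmul
  intro r b hb
  rw [add_zero]
  exact supportedIn_le 𝒜 (T := (residueComponent 𝒜 d r).comap (F : B →+ B))
    (fun i hi b hb => (show (i : ZMod d) = r from hi) ▸ hhom i b hb) hb

theorem isLocallyNilpotentDerivation_of_semiconj_veroneseSubring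
    {D : Derivation ℤ (veroneseSubring 𝒜 d) (veroneseSubring 𝒜 d)}
    (hD : IsLocallyNilpotentDerivation D)
    (hDF : Semiconj (algebraMap (veroneseSubring 𝒜 d) B) D F) :
    IsLocallyNilpotentDerivation F := by
  have hhom := isHomogeneousDerivation_residueComponent_zero (𝒜 := 𝒜) (d := d) (F := F)
    fun b hb => by
      have hFb : (D ⟨b, hb⟩ : B) = F b := hDF ⟨b, hb⟩
      exact hFb ▸ (D ⟨b, hb⟩).2
  refine isLocallyNilpotentDerivation_of_homogeneous 𝒜 fun i b hb => ?_
  refine exists_iterate_eq_zero_of_pow (S := residueComponent 𝒜 d i) (d := d) (fun c hc => ?_)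
    (fun c hc => ?_) (mem_residueComponent 𝒜 hb rfl)
  · simpa using hhom _ c hc
  · exact (hD ⟨_, pow_mem_veroneseSubring 𝒜 hc⟩).imp fun _ =>
      (iterate_algebraMap_eq_zero_iff hDF).2

theorem not_isRigidRing_of_not_isRigidRing_veroneseSubring {κ : Type*} [Fintype κ] [DecidableEq κ]
    [Nonempty κ] {x : κ → B} {δ : κ → ℤ} (hprime : ∀ i, Prime (x i)) (hhom : ∀ i, x i ∈ 𝒜 (δ i))
    (hgcd : ∀ i, (Finset.univ.erase i).gcd δ = 1)
    (hassoc : ∀ i j, i ≠ j → ¬ Associated (x i) (x j))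
    (h : ¬ IsRigidRing (veroneseSubring 𝒜 d)) : ¬ IsRigidRing B := by
  intro hrigid
  refine h fun D hD => ?_
  obtain ⟨F, hF⟩ := exists_derivation_semiconj_natCast_smul D hprime hhom hgcd hassoc
  have hF0 : F = 0 := hrigid F <| isLocallyNilpotentDerivation_of_semiconj_veroneseSubring
    (hD.smul (Derivation.map_natCast D d)) hF
  by_contra hne
  refine smul_derivation_ne_zero (Nat.cast_ne_zero.2 (NeZero.ne d)) hne
    (Derivation.ext fun a => ?_)
  have hFa := hF a
  rw [hF0] at hFa
  exact Subtype.ext hFa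

end Descent

theorem mainTheorem8_general {k B κ : Type*} [Field k] [CharZero k] [CommRing B] [IsDomain B]
    [Algebra k B] [Algebra.FiniteType k B] (𝒜 : ℤ → AddSubgroup B) [GradedRing 𝒜]
    [Fintype κ] [DecidableEq κ] [Nonempty κ] (x : κ → B) (δ : κ → ℤ)
    (hprime : ∀ i, Prime (x i))
    (hhom : ∀ i, x i ∈ 𝒜 (δ i))
    (hgcd : ∀ i, (Finset.univ.erase i).gcd δ = 1)
    (hassoc : ∀ i j, i ≠ j → ¬ Associated (x i) (x j)) :
    [¬ IsRigidRing B,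
      ∀ d : ℕ, 1 ≤ d → ¬ IsRigidRing (veroneseSubring 𝒜 d),
      ∃ d : ℕ, 1 ≤ d ∧ ¬ IsRigidRing (veroneseSubring 𝒜 d)].TFAE := by
  have : CharZero B := charZero_of_injective_algebraMap (algebraMap k B).injective
  tfae_have 1 → 2 := fun h d hd =>
    have : NeZero d := .of_pos hd
    not_isRigidRing_veroneseSubring_of_not_isRigidRing 𝒜 k hprime hhom hgcd hassoc d h
  tfae_have 2 → 3 := fun h => ⟨1, le_rfl, h 1 le_rfl⟩
  tfae_have 3 → 1 := fun ⟨d, hd, h⟩ =>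
    have : NeZero d := .of_pos hd
    not_isRigidRing_of_not_isRigidRing_veroneseSubring hprime hhom hgcd hassoc h
  tfae_finish

theorem mainTheorem8 {k B : Type*} [Field k] [CharZero k] [CommRing B] [IsDomain B]
    [IsIntegrallyClosed B] [Algebra k B] [Algebra.FiniteType k B]
    (𝒜 : ℤ → AddSubgroup B) [GradedRing 𝒜]
    (n : ℕ) (hn : 2 ≤ n) (x : Fin n → B) (δ : Fin n → ℤ)
    (hgen : Algebra.adjoin (𝒜 0) (Set.range x) = ⊤)
    (hprime : ∀ i, Prime (x i))
    (hhom : ∀ i, x i ∈ 𝒜 (δ i))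
    (hδ : ∀ i, δ i ≠ 0)
    (hgcd : ∀ i, (Finset.univ.erase i).gcd δ = 1)
    (hassoc : ∀ i j, i ≠ j → ¬ Associated (x i) (x j)) :
    [¬ IsRigidRing B,
      ∀ d : ℕ, 1 ≤ d → ¬ IsRigidRing (veroneseSubring 𝒜 d),
      ∃ d : ℕ, 1 ≤ d ∧ ¬ IsRigidRing (veroneseSubring 𝒜 d)].TFAE := by
  have : Nonempty (Fin n) := ⟨⟨0, by omega⟩⟩
  exact mainTheorem8_general (k := k) 𝒜 x δ hprime hhom hgcd hassoc
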